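/- Definitions. A \emph{premodel category} is a complete and cocomplete category $\mathcal C$ with two weak factorization systems, (cofibrations, anodyne fibrations) and (anodyne cofibrations, fibrations), such that every anodyne cofibration is a cofibration. An object $X$ is cofibrant if $0\to X$ is a cofibration and fibrant if $X\to 1$ is a fibration. An \emph{acyclic cofibration} is a cofibration with the left lifting property against all fibrations between fibrant objects; an \emph{acyclic fibration} is a fibration with the right lifting property against all cofibrations between cofibrant objects. A cofibration is \emph{core} if its domain is cofibrant; a fibration is \emph{core} if its target is fibrant. $\mathcal C$ is \emph{left saturated} (resp. \emph{core left saturated}) if every acyclic cofibration (resp. every core acyclic cofibration) is an anodyne cofibration, and \emph{right saturated} (resp. \emph{core right saturated}) if every acyclic fibration (resp. every core acyclic fibration) is an anodyne fibration. $\mathcal C$ is a \emph{weak model category} if (a) for every cofibration $A\to X$ with $A$ cofibrant and $X$ fibrant, the codiagonal factors as $X\coprod_A X\to I\to X$ where the first map is a cofibration and the composite of the first inclusion $X\to X\coprod_A X$ with it is an acyclic cofibration $X\to I$; and (b) for every fibration $A\to X$ with $A$ cofibrant and $X$ fibrant, the diagonal factors as $A\to P\to A\times_X A$ where the second map is a fibration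 and its composite with the first projection is an acyclic fibration $P\to A$. A \emph{strong cylinder object} for $X$ is a factorization $X\coprod X\to I\to X$ of the codiagonal whose first map is a cofibration and such that the composite of the first inclusion $X\to X\coprod X$ with it is an acyclic cofibration $X\to I$. A \emph{strong path object} for $X$ is a factorization $X\to P\to X\times X$ of the diagonal whose second map is a fibration and such that its composite with the first projection is an acyclic fibration $P\to X$. A complete and cocomplete category with classes of weak equivalences, cofibrations and fibrations is a \emph{Fresse left semi-model category} if: weak equivalences satisfy 2-out-of-3 and all three classes are stable under retracts; every map with cofibrant domain factors as a cofibration followed by a trivial fibration, and as a trivial cofibration followed by a fibration (trivial means being also a weak equivalence); every cofibration $i$ with cofibrant domain has the left lifting property against every fibration $p$ whenever $i$ or $p$ is a weak equivalence; fibrations are stable under pullback; the initial object is cofibrant. It is a \emph{Spitzweck left semi-model category} if moreover (cofibrations, trivial fibrations) is a weak factorization system. \emph{Fresse} and \emph{Spitzweck right semi-model categories} are the categorical duals (factorizations of maps with fibrant target, lifting of cofibrations against fibrations with fibrant target, cofibrations stable under pushout, terminal object fibrant; for Spitzweck, (trivial cofibrations, fibrations) is a weak factorization system). \textbf{Theorem.}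 Let $\mathcal C$ be a premodel category. (Left) There is a class $W$ of maps making $\mathcal C$, with its cofibrations and fibrations, a Fresse left semi-model category if and only if (1) $\mathcal C$ is a weak model category, (2) every cofibrant object of $\mathcal C$ has a strong cylinder object, and (3) $\mathcal C$ is core left saturated. When these conditions hold, $W$ is unique. There is a class $W$ making $\mathcal C$ a Spitzweck left semi-model category if and only if (1)--(3) hold and $\mathcal C$ is right saturated; and if $W$ makes $\mathcal C$ a Fresse left semi-model category, then it makes it a Spitzweck one if and only if $\mathcal C$ is right saturated. (Right) There is a class $W$ of maps making $\mathcal C$, with its cofibrations and fibrations, a Fresse right semi-model category if and only if (1') $\mathcal C$ is a weak model category, (2') every fibrant object of $\mathcal C$ has a strong path object, and (3') $\mathcal C$ is core right saturated. When these conditions hold, $W$ is unique. There is a class $W$ making $\mathcal C$ a Spitzweck right semi-model category if and only if (1')--(3') hold and $\mathcal C$ is left saturated; and if $W$ makes $\mathcal C$ a Fresse right semi-model category, then it makes it a Spitzweck one if and only if $\mathcal C$ is left saturated. -/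

import Mathlib

open CategoryTheory Limits

universe v u

/-- The data of a premodel category on a category `C` (which will be assumed complete and
cocomplete): two weak factorization systems (cofibrations, anodyne fibrations) and
(anodyne cofibrations, fibrations) such that anodyne cofibrations are cofibrations. -/
structure PremodelStructure (C : Type u) [Category.{v} C] where
  /-- the cofibrations -/
  cof : MorphismProperty C
  /-- the anodyne fibrations -/
  anFib : MorphismProperty C
  /-- the anodyne cofibrations -/
  anCof : MorphismProperty C
  /-- the fibrations -/
  fib : MorphismProperty C
  wfs_cof_anFib : cof.IsWeakFactorizationSystem anFib
  wfs_anCof_fib : anCof.IsWeakFactorizationSystem fib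
  anCof_le_cof : anCof ≤ cof

section Objects

variable {C : Type u} [Category.{v} C]

/-- `X` is cofibrant with respect to a class `cof` if `0 ⟶ X` belongs to `cof`. -/
def CofibrantFor [HasInitial C] (cof : MorphismProperty C) (X : C) : Prop :=
  cof (initial.to X)

/-- `X` is fibrant with respect to a class `fib` if `X ⟶ 1` belongs to `fib`. -/
def FibrantFor [HasTerminal C] (fib : MorphismProperty C) (X : C) : Prop :=
  fib (terminal.from X)

end Objects

namespace PremodelStructure

variable {C : Type u} [Category.{v} C] [HasLimits C] [HasColimits C] (P : PremodelStructure C)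

/-- Cofibrant objects of a premodel category. -/
def Cofibrant (X : C) : Prop := CofibrantFor P.cof X

/-- Fibrant objects of a premodel category. -/
def Fibrant (X : C) : Prop := FibrantFor P.fib X

/-- Acyclic cofibrations: cofibrations with the left lifting property against all fibrations
between fibrant objects. -/
def acCof : MorphismProperty C := fun _ _ i =>
  P.cof i ∧ ∀ ⦃X Y : C⦄ (p : X ⟶ Y), P.Fibrant X → P.Fibrant Y → P.fib p →
    HasLiftingProperty i p

/-- Acyclic fibrations: fibrations with the right lifting property against all cofibrations
between cofibrant objects. -/
def acFib : MorphismProperty C := fun _ _ p =>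
  P.fib p ∧ ∀ ⦃A B : C⦄ (i : A ⟶ B), P.Cofibrant A → P.Cofibrant B → P.cof i →
    HasLiftingProperty i p

/-- A relative strong cylinder object for `i : A ⟶ X`: a factorization
`X ⨿_A X ⟶ I ⟶ X` of the codiagonal whose first map is a cofibration and such that the
first map `X ⟶ I` is an acyclic cofibration. -/
def HasRelStrongCylinder {A X : C} (i : A ⟶ X) : Prop :=
  ∃ (I : C) (j : pushout i i ⟶ I) (q : I ⟶ X),
    j ≫ q = pushout.desc (𝟙 X) (𝟙 X) rfl ∧ P.cof j ∧ P.acCof (pushout.inl i i ≫ j)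

/-- A relative strong path object for `p : A ⟶ X`: a factorization
`A ⟶ Q ⟶ A ×_X A` of the diagonal whose second map is a fibration and such that the
first map `Q ⟶ A` is an acyclic fibration. -/
def HasRelStrongPath {A X : C} (p : A ⟶ X) : Prop :=
  ∃ (Q : C) (s : A ⟶ Q) (r : Q ⟶ pullback p p),
    s ≫ r = pullback.lift (𝟙 A) (𝟙 A) rfl ∧ P.fib r ∧ P.acFib (r ≫ pullback.fst p p)

/-- A premodel category is a weak model category if it satisfies the cylinder axiom and the
path object axiom. -/
structure IsWeakModel : Prop where
  cylinder : ∀ ⦃A X : C⦄ (i : A ⟶ X), P.Cofibrant A → P.Fibrant X → P.cof i →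
    P.HasRelStrongCylinder i
  path : ∀ ⦃A X : C⦄ (p : A ⟶ X), P.Cofibrant A → P.Fibrant X → P.fib p →
    P.HasRelStrongPath p

/-- A strong cylinder object for `X`: a factorization `X ⨿ X ⟶ I ⟶ X` of the codiagonal whose
first map is a cofibration and such that the composite of the first coproduct inclusion with it
is an acyclic cofibration. -/
def HasStrongCylinder (X : C) : Prop :=
  ∃ (I : C) (j : X ⨿ X ⟶ I) (q : I ⟶ X),
    j ≫ q = coprod.desc (𝟙 X) (𝟙 X) ∧ P.cof j ∧ P.acCof (coprod.inl ≫ j)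

/-- A strong path object for `X`: a factorization `X ⟶ Q ⟶ X × X` of the diagonal whose second
map is a fibration and such that its composite with the first projection is an acyclic
fibration. -/
def HasStrongPath (X : C) : Prop :=
  ∃ (Q : C) (s : X ⟶ Q) (r : Q ⟶ X ⨯ X),
    s ≫ r = prod.lift (𝟙 X) (𝟙 X) ∧ P.fib r ∧ P.acFib (r ≫ prod.fst)

/-- Left saturated: all acyclic cofibrations are anodyne. -/
def LeftSaturated : Prop := P.acCof ≤ P.anCof

/-- Right saturated: all acyclic fibrations are anodyne. -/
def RightSaturated : Prop := P.acFib ≤ P.anFib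

/-- Core left saturated: all acyclic cofibrations with cofibrant domain are anodyne. -/
def CoreLeftSaturated : Prop :=
  ∀ ⦃A B : C⦄ (i : A ⟶ B), P.Cofibrant A → P.acCof i → P.anCof i

/-- Core right saturated: all acyclic fibrations with fibrant target are anodyne. -/
def CoreRightSaturated : Prop :=
  ∀ ⦃X Y : C⦄ (p : X ⟶ Y), P.Fibrant Y → P.acFib p → P.anFib p

end PremodelStructure

section SemiModel

variable {C : Type u} [Category.{v} C] [HasLimits C] [HasColimits C]

/-- Fresse left semi-model categories, with weak equivalences `W`, cofibrations `cof` and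
fibrations `fib`. -/
structure IsFresseLeftSemiModel (W cof fib : MorphismProperty C) : Prop where
  two_out_of_three : W.HasTwoOutOfThreeProperty
  retract_W : W.IsStableUnderRetracts
  retract_cof : cof.IsStableUnderRetracts
  retract_fib : fib.IsStableUnderRetracts
  fact_cof_trivFib : ∀ ⦃X Y : C⦄ (f : X ⟶ Y), CofibrantFor cof X →
    ∃ (Z : C) (i : X ⟶ Z) (p : Z ⟶ Y), i ≫ p = f ∧ cof i ∧ fib p ∧ W p
  fact_trivCof_fib : ∀ ⦃X Y : C⦄ (f : X ⟶ Y), CofibrantFor cof X →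
    ∃ (Z : C) (i : X ⟶ Z) (p : Z ⟶ Y), i ≫ p = f ∧ cof i ∧ W i ∧ fib p
  lift : ∀ ⦃A B X Y : C⦄ (i : A ⟶ B) (p : X ⟶ Y), CofibrantFor cof A → cof i → fib p →
    (W i ∨ W p) → HasLiftingProperty i p
  pullback_fib : fib.IsStableUnderBaseChange
  cofibrant_initial : CofibrantFor cof (⊥_ C)

/-- Spitzweck left semi-model categories: Fresse left semi-model categories where cofibrations
and trivial fibrations form a weak factorization system. -/
structure IsSpitzweckLeftSemiModel (W cof fib : MorphismProperty C) : Prop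
    extends IsFresseLeftSemiModel W cof fib where
  wfs : cof.IsWeakFactorizationSystem (fib ⊓ W)

/-- Fresse right semi-model categories: the categorical dual of Fresse left semi-model
categories. -/
structure IsFresseRightSemiModel (W cof fib : MorphismProperty C) : Prop where
  two_out_of_three : W.HasTwoOutOfThreeProperty
  retract_W : W.IsStableUnderRetracts
  retract_cof : cof.IsStableUnderRetracts
  retract_fib : fib.IsStableUnderRetracts
  fact_cof_trivFib : ∀ ⦃X Y : C⦄ (f : X ⟶ Y), FibrantFor fib Y →
    ∃ (Z : C) (i : X ⟶ Z) (p : Z ⟶ Y), i ≫ p = f ∧ cof i ∧ fib p ∧ W p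
  fact_trivCof_fib : ∀ ⦃X Y : C⦄ (f : X ⟶ Y), FibrantFor fib Y →
    ∃ (Z : C) (i : X ⟶ Z) (p : Z ⟶ Y), i ≫ p = f ∧ cof i ∧ W i ∧ fib p
  lift : ∀ ⦃A B X Y : C⦄ (i : A ⟶ B) (p : X ⟶ Y), FibrantFor fib Y → cof i → fib p →
    (W i ∨ W p) → HasLiftingProperty i p
  pushout_cof : cof.IsStableUnderCobaseChange
  fibrant_terminal : FibrantFor fib (⊤_ C)

/-- Spitzweck right semi-model categories: Fresse right semi-model categories where trivial
cofibrations and fibrations form a weak factorization system. -/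
structure IsSpitzweckRightSemiModel (W cof fib : MorphismProperty C) : Prop
    extends IsFresseRightSemiModel W cof fib where
  wfs : (cof ⊓ W).IsWeakFactorizationSystem fib

end SemiModel

/-!
The theorem for right semi-model categories follows from the one for left semi-model categories
applied to the opposite premodel category, so only the latter is discussed.

*From a Fresse left semi-model structure `W` to the conditions.* The retract argument shows that the
fibrations in `W` are exactly the acyclic fibrations (`inf_eq_acFib`), and that the core cofibrations
in `W` are exactly the core anodyne cofibrations (`anCof_of_trivCof`, `weq_of_anCof`). The conditions
are then obtained from the factorizations of codiagonals and diagonals. Moreover a map `f : X ⟶ Y`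
belongs to `W` if and only if the composite with a cofibrant replacement `X' ⟶ X` factors as an
anodyne cofibration followed by an anodyne fibration; this gives the uniqueness of `W` (`le`). Since
the trivial fibrations are the acyclic fibrations, the Spitzweck condition is right saturation.

*From the conditions to `W`.* Let `B` be cofibrant and let `Z` be bifibrant, so that `B` has a strong
cylinder object, and `Z` has a strong path object by the path object axiom for `Z ⟶ 1`. Left and
right homotopy of maps `B ⟶ Z` coincide, for all choices of the cylinder and of the path object, and
this is an equivalence relation. Two lifts along an anodyne fibration of a map out of a cofibrant
object are left homotopic, so homotopy classes of maps from a cofibrant replacement of `X` to `Z`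
are a functor of an arbitrary object `X`. Let `W` (`leftWeq`) consist of the maps that all of these
functors, for `Z` bifibrant, send to bijections. It satisfies 2-out-of-3, is stable under retracts,
and contains the anodyne fibrations and the core anodyne cofibrations.

The main point is that, conversely, a core cofibration in `W` is acyclic (`IsHoEquiv.acCof`), hence
anodyne by core left saturation. This reduces to the fact that a fibration `q : Z ⟶ B` in `W` between
bifibrant objects is acyclic (`IsHoEquiv.acFib`). Such a `q` has a section `s` with a homotopy `H`
from `q ≫ s` to the identity. The homotopies `H` and `H ≫ q ≫ s` have the same start and the same
projection to `B`, so a lift to the relative path object of `q` compares them over `B`; at the end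
points this is a homotopy over `B` between the identity and `q ≫ s`, which yields the required lifts.
Finally, the retract argument gives the lifting property of core cofibrations against the fibrations
in `W`.
-/

set_option linter.unusedSectionVars false

namespace PremodelStructure

variable {C : Type u} [Category.{v} C] [HasLimits C] [HasColimits C] (P : PremodelStructure C)

/-! ### Closure properties of the four classes -/

instance : P.cof.IsWeakFactorizationSystem P.anFib := P.wfs_cof_anFib

instance : P.anCof.IsWeakFactorizationSystem P.fib := P.wfs_anCof_fib

instance : P.cof.IsStableUnderRetracts :=
  MorphismProperty.llp_eq_of_wfs P.cof P.anFib ▸ inferInstance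

instance : P.cof.IsMultiplicative :=
  MorphismProperty.llp_eq_of_wfs P.cof P.anFib ▸ inferInstance

instance : P.cof.IsStableUnderCobaseChange :=
  MorphismProperty.llp_eq_of_wfs P.cof P.anFib ▸ inferInstance

instance : P.fib.IsStableUnderRetracts :=
  MorphismProperty.rlp_eq_of_wfs P.anCof P.fib ▸ inferInstance

instance : P.fib.IsMultiplicative :=
  MorphismProperty.rlp_eq_of_wfs P.anCof P.fib ▸ inferInstance

instance : P.fib.IsStableUnderBaseChange :=
  MorphismProperty.rlp_eq_of_wfs P.anCof P.fib ▸ inferInstance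

instance : P.anFib.IsStableUnderRetracts :=
  MorphismProperty.rlp_eq_of_wfs P.cof P.anFib ▸ inferInstance

instance : P.anFib.IsMultiplicative :=
  MorphismProperty.rlp_eq_of_wfs P.cof P.anFib ▸ inferInstance

variable {P}

lemma hasLiftingProperty_cof_anFib {A B X Y : C} {i : A ⟶ B} {p : X ⟶ Y}
    (hi : P.cof i) (hp : P.anFib p) : HasLiftingProperty i p :=
  MorphismProperty.hasLiftingProperty_of_wfs i p hi hp

lemma hasLiftingProperty_anCof_fib {A B X Y : C} {i : A ⟶ B} {p : X ⟶ Y}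
    (hi : P.anCof i) (hp : P.fib p) : HasLiftingProperty i p :=
  MorphismProperty.hasLiftingProperty_of_wfs i p hi hp

lemma exists_cof_anFib {X Y : C} (f : X ⟶ Y) :
    ∃ (Z : C) (i : X ⟶ Z) (p : Z ⟶ Y), i ≫ p = f ∧ P.cof i ∧ P.anFib p :=
  let d := P.cof.factorizationData P.anFib f
  ⟨d.Z, d.i, d.p, d.fac, d.hi, d.hp⟩

lemma exists_anCof_fib {X Y : C} (f : X ⟶ Y) :
    ∃ (Z : C) (i : X ⟶ Z) (p : Z ⟶ Y), i ≫ p = f ∧ P.anCof i ∧ P.fib p :=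
  let d := P.anCof.factorizationData P.fib f
  ⟨d.Z, d.i, d.p, d.fac, d.hi, d.hp⟩

lemma anCof_of_lifting {A B : C} {i : A ⟶ B}
    (h : ∀ ⦃X Y : C⦄ (p : X ⟶ Y), P.fib p → HasLiftingProperty i p) : P.anCof i := by
  rw [← MorphismProperty.llp_eq_of_wfs P.anCof P.fib]
  exact fun _ _ p hp => h p hp

lemma anFib_le_fib : P.anFib ≤ P.fib := by
  intro X Y p hp
  rw [← MorphismProperty.rlp_eq_of_wfs P.anCof P.fib]
  exact fun _ _ i hi => hasLiftingProperty_cof_anFib (P.anCof_le_cof i hi) hp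

lemma anFib_le_acFib : P.anFib ≤ P.acFib := fun _ _ p hp =>
  ⟨anFib_le_fib p hp, fun _ _ _ _ _ hi => hasLiftingProperty_cof_anFib hi hp⟩

lemma anCof_le_acCof : P.anCof ≤ P.acCof := fun _ _ i hi =>
  ⟨P.anCof_le_cof i hi, fun _ _ _ _ _ hp => hasLiftingProperty_anCof_fib hi hp⟩

lemma Cofibrant.of_cof {A B : C} {i : A ⟶ B} (hA : P.Cofibrant A) (hi : P.cof i) :
    P.Cofibrant B := by
  have : initial.to B = initial.to A ≫ i := by ext
  unfold Cofibrant CofibrantFor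
  rw [this]
  exact P.cof.comp_mem _ _ hA hi

lemma Fibrant.of_fib {X Y : C} {p : X ⟶ Y} (hY : P.Fibrant Y) (hp : P.fib p) :
    P.Fibrant X := by
  have : terminal.from X = p ≫ terminal.from Y := by ext
  unfold Fibrant FibrantFor
  rw [this]
  exact P.fib.comp_mem _ _ hp hY

lemma cofibrant_iff_of_isInitial {T : C} (hT : IsInitial T) {X : C} (f : T ⟶ X) :
    P.Cofibrant X ↔ P.cof f := by
  have : f = (hT.uniqueUpToIso initialIsInitial).hom ≫ initial.to X := hT.hom_ext _ _
  rw [this, P.cof.cancel_left_of_respectsIso]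
  rfl

lemma fibrant_iff_of_isTerminal {T : C} (hT : IsTerminal T) {X : C} (f : X ⟶ T) :
    P.Fibrant X ↔ P.fib f := by
  have : f = terminal.from X ≫ (terminalIsTerminal.uniqueUpToIso hT).hom := hT.hom_ext _ _
  rw [this, P.fib.cancel_right_of_respectsIso]
  rfl

lemma cofibrant_initial : P.Cofibrant (⊥_ C) :=
  (cofibrant_iff_of_isInitial initialIsInitial (𝟙 _)).2 (P.cof.id_mem _)

lemma cof_coprod_inl {X Y : C} (hY : P.Cofibrant Y) : P.cof (coprod.inl : X ⟶ X ⨿ Y) :=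
  MorphismProperty.of_isPushout
    (IsPushout.of_is_coproduct' (coprodIsCoprod X Y) initialIsInitial)
    ((cofibrant_iff_of_isInitial initialIsInitial _).1 hY)

lemma cofibrant_coprod {X Y : C} (hX : P.Cofibrant X) (hY : P.Cofibrant Y) :
    P.Cofibrant (X ⨿ Y) := hX.of_cof (cof_coprod_inl hY)

lemma Cofibrant.exists_lift_anFib {A X Y : C} (hA : P.Cofibrant A) {p : X ⟶ Y}
    (hp : P.anFib p) (f : A ⟶ Y) : ∃ g : A ⟶ X, g ≫ p = f := by
  have := hasLiftingProperty_cof_anFib (p := p) hA hp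
  have sq : CommSq (initial.to X) (initial.to A) p f := ⟨by ext⟩
  exact ⟨sq.lift, sq.fac_right⟩

lemma Fibrant.exists_extension_anCof {A B Z : C} (hZ : P.Fibrant Z) {i : A ⟶ B}
    (hi : P.anCof i) (f : A ⟶ Z) : ∃ g : B ⟶ Z, i ≫ g = f := by
  have := hasLiftingProperty_anCof_fib (p := terminal.from Z) hi hZ
  have sq : CommSq f i (terminal.from Z) (terminal.from B) := ⟨by ext⟩
  exact ⟨sq.lift, sq.fac_left⟩

lemma exists_fibrant_replacement (X : C) :
    ∃ (Z : C) (i : X ⟶ Z), P.anCof i ∧ P.Fibrant Z := by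
  obtain ⟨Z, i, p, -, hi, hp⟩ := P.exists_anCof_fib (terminal.from X)
  exact ⟨Z, i, hi, (fibrant_iff_of_isTerminal terminalIsTerminal p).2 hp⟩

lemma exists_cofibrant_replacement (X : C) :
    ∃ (Z : C) (p : Z ⟶ X), P.anFib p ∧ P.Cofibrant Z := by
  obtain ⟨Z, i, p, -, hi, hp⟩ := P.exists_cof_anFib (initial.to X)
  exact ⟨Z, p, hp, (cofibrant_iff_of_isInitial initialIsInitial i).2 hi⟩

/-! ### Cylinders and path objects relative to chosen pushouts and pullbacks -/

lemma hasRelStrongCylinder_iff {A X T : C} {i : A ⟶ X} {a b : X ⟶ T} (h : IsPushout i i a b) :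
    P.HasRelStrongCylinder i ↔ ∃ (I : C) (j : T ⟶ I) (q : I ⟶ X),
      a ≫ j ≫ q = 𝟙 X ∧ b ≫ j ≫ q = 𝟙 X ∧ P.cof j ∧ P.acCof (a ≫ j) := by
  constructor
  · rintro ⟨I, j, q, hq, hj, hj'⟩
    refine ⟨I, h.isoPushout.hom ≫ j, q, ?_, ?_, ?_, ?_⟩
    · simp [hq, pushout.inl_desc]
    · simp [hq, pushout.inr_desc]
    · rwa [P.cof.cancel_left_of_respectsIso]
    · simpa using hj'
  · rintro ⟨I, j, q, ha, hb, hj, hj'⟩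
    refine ⟨I, h.isoPushout.inv ≫ j, q, ?_, ?_, ?_⟩
    · ext <;> simp [ha, hb, pushout.inl_desc, pushout.inr_desc]
    · rwa [P.cof.cancel_left_of_respectsIso]
    · simpa using hj'

lemma hasRelStrongPath_iff {A X T : C} {p : A ⟶ X} {a b : T ⟶ A} (h : IsPullback a b p p) :
    P.HasRelStrongPath p ↔ ∃ (Q : C) (s : A ⟶ Q) (r : Q ⟶ T),
      s ≫ r ≫ a = 𝟙 A ∧ s ≫ r ≫ b = 𝟙 A ∧ P.fib r ∧ P.acFib (r ≫ a) := by
  constructor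
  · rintro ⟨Q, s, r, hs, hr, hr'⟩
    refine ⟨Q, s, r ≫ h.isoPullback.inv, ?_, ?_, ?_, ?_⟩
    · simp [reassoc_of% hs, pullback.lift_fst]
    · simp [reassoc_of% hs, pullback.lift_snd]
    · rwa [P.fib.cancel_right_of_respectsIso]
    · simpa using hr'
  · rintro ⟨Q, s, r, ha, hb, hr, hr'⟩
    refine ⟨Q, s, r ≫ h.isoPullback.hom, ?_, ?_, ?_⟩
    · ext <;> simp [ha, hb, pullback.lift_fst, pullback.lift_snd]
    · rwa [P.fib.cancel_right_of_respectsIso]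
    · simpa using hr'

lemma hasStrongCylinder_iff {X T : C} {a b : X ⟶ T} (h : IsColimit (BinaryCofan.mk a b)) :
    P.HasStrongCylinder X ↔ ∃ (I : C) (j : T ⟶ I) (q : I ⟶ X),
      a ≫ j ≫ q = 𝟙 X ∧ b ≫ j ≫ q = 𝟙 X ∧ P.cof j ∧ P.acCof (a ≫ j) := by
  obtain ⟨e, hl, hr⟩ : ∃ e : T ≅ X ⨿ X, a ≫ e.hom = coprod.inl ∧ b ≫ e.hom = coprod.inr := by
    let k := colimit.isColimit (pair X X)
    exact ⟨h.coconePointUniqueUpToIso k, h.comp_coconePointUniqueUpToIso_hom k ⟨.left⟩,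
      h.comp_coconePointUniqueUpToIso_hom k ⟨.right⟩⟩
  have hl' : coprod.inl ≫ e.inv = a := by simp [← hl]
  have hr' : coprod.inr ≫ e.inv = b := by simp [← hr]
  constructor
  · rintro ⟨I, j, q, hq, hj, hj'⟩
    refine ⟨I, e.hom ≫ j, q, ?_, ?_, ?_, ?_⟩
    · simp [reassoc_of% hl, hq, coprod.inl_desc]
    · simp [reassoc_of% hr, hq, coprod.inr_desc]
    · rwa [P.cof.cancel_left_of_respectsIso]
    · simpa [reassoc_of% hl] using hj'
  · rintro ⟨I, j, q, ha, hb, hj, hj'⟩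
    refine ⟨I, e.inv ≫ j, q, ?_, ?_, ?_⟩
    · ext <;> simp [reassoc_of% hl', reassoc_of% hr', ha, hb, coprod.inl_desc, coprod.inr_desc]
    · rwa [P.cof.cancel_left_of_respectsIso]
    · simpa [reassoc_of% hl'] using hj'

lemma hasStrongPath_iff {X T : C} {a b : T ⟶ X} (h : IsLimit (BinaryFan.mk a b)) :
    P.HasStrongPath X ↔ ∃ (Q : C) (s : X ⟶ Q) (r : Q ⟶ T),
      s ≫ r ≫ a = 𝟙 X ∧ s ≫ r ≫ b = 𝟙 X ∧ P.fib r ∧ P.acFib (r ≫ a) := by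
  obtain ⟨e, hl, hr⟩ : ∃ e : T ≅ X ⨯ X, e.inv ≫ a = prod.fst ∧ e.inv ≫ b = prod.snd := by
    let k := limit.isLimit (pair X X)
    exact ⟨h.conePointUniqueUpToIso k, h.conePointUniqueUpToIso_inv_comp k ⟨.left⟩,
      h.conePointUniqueUpToIso_inv_comp k ⟨.right⟩⟩
  have hl' : e.hom ≫ prod.fst = a := by simp [← hl]
  have hr' : e.hom ≫ prod.snd = b := by simp [← hr]
  constructor
  · rintro ⟨Q, s, r, hs, hq, hq'⟩
    refine ⟨Q, s, r ≫ e.inv, ?_, ?_, ?_, ?_⟩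
    · simp [hl, reassoc_of% hs, prod.lift_fst]
    · simp [hr, reassoc_of% hs, prod.lift_snd]
    · rwa [P.fib.cancel_right_of_respectsIso]
    · simpa [hl] using hq'
  · rintro ⟨Q, s, r, ha, hb, hq, hq'⟩
    refine ⟨Q, s, r ≫ e.hom, ?_, ?_, ?_⟩
    · ext <;> simp [hl', hr', ha, hb, prod.lift_fst, prod.lift_snd]
    · rwa [P.fib.cancel_right_of_respectsIso]
    · simpa [hl'] using hq'

end PremodelStructure

/-! ### Consequences of a Fresse left semi-model structure -/

namespace IsFresseLeftSemiModel

open PremodelStructure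

variable {C : Type u} [Category.{v} C] [HasLimits C] [HasColimits C] {P : PremodelStructure C}
  {W : MorphismProperty C} (h : IsFresseLeftSemiModel W P.cof P.fib)

include h

lemma acFib_of_trivFib {X Y : C} {p : X ⟶ Y} (hp : P.fib p) (hW : W p) : P.acFib p :=
  ⟨hp, fun _ _ i hA _ hi => h.lift i p hA hi hp (Or.inr hW)⟩

/-- If the domain of the acyclic fibration `p` is cofibrant, then `p` is a retract of the trivial
fibration in a factorization of `p`; the general case follows by composing `p` with a cofibrant
replacement of its domain. -/
lemma weq_of_acFib {X Y : C} {p : X ⟶ Y} (hp : P.acFib p) : W p := by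
  have := h.two_out_of_three
  have := h.retract_W
  have key : ∀ {X Y : C} (p : X ⟶ Y), P.Cofibrant X → P.acFib p → W p := by
    intro X Y p hX hp
    obtain ⟨Z, i, t, fac, hi, -, ht⟩ := h.fact_cof_trivFib p hX
    have := hp.2 i hX (hX.of_cof hi) hi
    exact W.of_retract (RetractArrow.ofRightLiftingProperty fac) ht
  have comp : ∀ {X Y Z : C} (e : X ⟶ Y) (p : Y ⟶ Z), P.acFib e → P.acFib p →
      P.acFib (e ≫ p) := fun e p he hp => ⟨P.fib.comp_mem _ _ he.1 hp.1, fun A B i hA hB hi => by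
        have := he.2 i hA hB hi
        have := hp.2 i hA hB hi
        infer_instance⟩
  obtain ⟨X', e, he, hX'⟩ := P.exists_cofibrant_replacement X
  exact W.of_precomp e p (key e hX' (anFib_le_acFib _ he))
    (key _ hX' (comp e p (anFib_le_acFib _ he) hp))

lemma inf_eq_acFib : P.fib ⊓ W = P.acFib :=
  le_antisymm (fun _ _ _ hp => h.acFib_of_trivFib hp.1 hp.2)
    fun _ _ _ hp => ⟨hp.1, h.weq_of_acFib hp⟩

lemma weq_of_anFib {X Y : C} {p : X ⟶ Y} (hp : P.anFib p) : W p :=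
  h.weq_of_acFib (anFib_le_acFib _ hp)

lemma weq_id (X : C) : W (𝟙 X) := h.weq_of_anFib (P.anFib.id_mem X)

lemma anCof_of_trivCof {A B : C} {i : A ⟶ B} (hA : P.Cofibrant A) (hi : P.cof i) (hW : W i) :
    P.anCof i :=
  anCof_of_lifting fun _ _ p hp => h.lift i p hA hi hp (Or.inl hW)

lemma weq_of_anCof {A B : C} {i : A ⟶ B} (hA : P.Cofibrant A) (hi : P.anCof i) : W i := by
  have := h.retract_W
  obtain ⟨Z, j, p, fac, -, hj, hp⟩ := h.fact_trivCof_fib i hA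
  have := hasLiftingProperty_anCof_fib hi hp
  exact W.of_retract (RetractArrow.ofLeftLiftingProperty fac) hj

lemma acCof_of_trivCof {A B : C} {i : A ⟶ B} (hA : P.Cofibrant A) (hi : P.cof i) (hW : W i) :
    P.acCof i :=
  anCof_le_acCof _ (h.anCof_of_trivCof hA hi hW)

/-- The weak equivalences of a Fresse left semi-model structure are determined by the cofibrations
and the fibrations: after replacing the domain by a cofibrant object, `f` is a weak equivalence
if and only if it factors as an anodyne cofibration followed by an anodyne fibration. -/
lemma le {W' : MorphismProperty C} (h' : IsFresseLeftSemiModel W' P.cof P.fib) : W ≤ W' := by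
  intro X Y f hf
  have := h.two_out_of_three
  have := h'.two_out_of_three
  obtain ⟨X', e, he, hX'⟩ := P.exists_cofibrant_replacement X
  obtain ⟨Z, i, p, fac, hi, hp⟩ := P.exists_cof_anFib (e ≫ f)
  have h₁ : W (i ≫ p) := fac ▸ W.comp_mem _ _ (h.weq_of_anFib he) hf
  have h₂ : W i := W.of_postcomp i p (h.weq_of_anFib hp) h₁
  have h₃ : W' i := h'.weq_of_anCof hX' (h.anCof_of_trivCof hX' hi h₂)
  have h₄ : W' (e ≫ f) := fac ▸ W'.comp_mem _ _ h₃ (h'.weq_of_anFib hp)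
  exact W'.of_precomp e f (h'.weq_of_anFib he) h₄

lemma isSpitzweck_iff : IsSpitzweckLeftSemiModel W P.cof P.fib ↔ P.RightSaturated := by
  constructor
  · intro hS
    have hwfs := hS.wfs
    rw [h.inf_eq_acFib] at hwfs
    exact (hwfs.rlp.symm.trans P.wfs_cof_anFib.rlp).le
  · intro hP
    refine { h with wfs := ?_ }
    rw [h.inf_eq_acFib, le_antisymm hP anFib_le_acFib]
    exact P.wfs_cof_anFib

/-- A core acyclic cofibration `i : A ⟶ B` becomes a weak equivalence after composition with a
fibrant replacement of `B`, because it then is a retract of the trivial cofibration in a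
factorization. -/
lemma coreLeftSaturated : P.CoreLeftSaturated := by
  intro A B i hA hi
  have := h.two_out_of_three
  have := h.retract_W
  obtain ⟨B', j, hj, hB'⟩ := P.exists_fibrant_replacement B
  obtain ⟨Z, k, p, fac, -, hk, hp⟩ := h.fact_trivCof_fib (i ≫ j) hA
  have := hi.2 p (hB'.of_fib hp) hB' hp
  have := hasLiftingProperty_anCof_fib hj hp
  have hW : W (i ≫ j) := W.of_retract (RetractArrow.ofLeftLiftingProperty fac) hk
  exact h.anCof_of_trivCof hA hi.1
    (W.of_postcomp i j (h.weq_of_anCof (hA.of_cof hi.1) hj) hW)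

lemma hasStrongCylinder {X : C} (hX : P.Cofibrant X) : P.HasStrongCylinder X := by
  have := h.two_out_of_three
  obtain ⟨I, j, q, fac, hj, -, hq⟩ :=
    h.fact_cof_trivFib (coprod.desc (𝟙 X) (𝟙 X)) (cofibrant_coprod hX hX)
  refine ⟨I, j, q, fac, hj, h.acCof_of_trivCof hX
    (P.cof.comp_mem _ _ (cof_coprod_inl hX) hj) (W.of_postcomp _ q hq ?_)⟩
  rw [Category.assoc, fac, coprod.inl_desc]
  exact h.weq_id X

lemma isWeakModel : P.IsWeakModel where
  cylinder A X i hA _ hi := by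
    have := h.two_out_of_three
    have hinl : P.cof (pushout.inl i i) :=
      MorphismProperty.of_isPushout (IsPushout.of_hasPushout i i) hi
    have hX := hA.of_cof hi
    obtain ⟨I, j, q, fac, hj, -, hq⟩ :=
      h.fact_cof_trivFib (pushout.desc (𝟙 X) (𝟙 X) rfl : pushout i i ⟶ X) (hX.of_cof hinl)
    refine ⟨I, j, q, fac, hj, h.acCof_of_trivCof hX
      (P.cof.comp_mem _ _ hinl hj) (W.of_postcomp _ q hq ?_)⟩
    rw [Category.assoc, fac, pushout.inl_desc]
    exact h.weq_id X
  path A X p hA _ hp := by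
    have := h.two_out_of_three
    have hfst : P.fib (pullback.fst p p) :=
      MorphismProperty.of_isPullback (IsPullback.of_hasPullback p p).flip hp
    obtain ⟨Q, s, r, fac, -, hs, hr⟩ :=
      h.fact_trivCof_fib (pullback.lift (𝟙 A) (𝟙 A) rfl : A ⟶ pullback p p) hA
    refine ⟨Q, s, r, fac, hr, h.acFib_of_trivFib (P.fib.comp_mem _ _ hr hfst)
      (W.of_precomp s _ hs ?_)⟩
    rw [reassoc_of% fac, pullback.lift_fst]
    exact h.weq_id A

end IsFresseLeftSemiModel

namespace PremodelStructure

variable {C : Type u} [Category.{v} C] [HasLimits C] [HasColimits C] (P : PremodelStructure C)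

/-! ### Homotopies -/

/-- The data of a strong cylinder object for `B`, with the map `B ⨿ B ⟶ I` given by its two
components. -/
structure Cylinder (B : C) where
  /-- the cylinder object -/
  I : C
  /-- the inclusion of the start -/
  ι₀ : B ⟶ I
  /-- the inclusion of the end -/
  ι₁ : B ⟶ I
  /-- the projection -/
  π : I ⟶ B
  ι₀_π : ι₀ ≫ π = 𝟙 B
  ι₁_π : ι₁ ≫ π = 𝟙 B
  cof : P.cof (coprod.desc ι₀ ι₁)
  acCof : P.acCof ι₀

/-- The data of a relative strong path object for `p : Z ⟶ Y`, with the map from the path object to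
`Z ×_Y Z` given by its two components. For `Y = 1`, this is a strong path object for `Z`. -/
structure RelPath {Z Y : C} (p : Z ⟶ Y) where
  /-- the path object -/
  Q : C
  /-- the inclusion of the constant paths -/
  σ : Z ⟶ Q
  /-- the starting point of a path -/
  p₀ : Q ⟶ Z
  /-- the end point of a path -/
  p₁ : Q ⟶ Z
  σ_p₀ : σ ≫ p₀ = 𝟙 Z
  σ_p₁ : σ ≫ p₁ = 𝟙 Z
  w : p₀ ≫ p = p₁ ≫ p
  fib : P.fib (pullback.lift p₀ p₁ w)
  acFib : P.acFib p₀

attribute [simp] Cylinder.ι₀_π Cylinder.ι₁_π RelPath.σ_p₀ RelPath.σ_p₁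

@[simp]
lemma Cylinder.ι₀_π_assoc {B T : C} (I : P.Cylinder B) (f : B ⟶ T) : I.ι₀ ≫ I.π ≫ f = f := by
  rw [reassoc_of% I.ι₀_π]

@[simp]
lemma Cylinder.ι₁_π_assoc {B T : C} (I : P.Cylinder B) (f : B ⟶ T) : I.ι₁ ≫ I.π ≫ f = f := by
  rw [reassoc_of% I.ι₁_π]

variable {P}

lemma HasStrongCylinder.nonempty {B : C} (h : P.HasStrongCylinder B) :
    Nonempty (P.Cylinder B) := by
  obtain ⟨I, j, q, fac, hj, hj'⟩ := h
  refine ⟨⟨I, coprod.inl ≫ j, coprod.inr ≫ j, q, ?_, ?_, ?_, hj'⟩⟩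
  · rw [Category.assoc, fac, coprod.inl_desc]
  · rw [Category.assoc, fac, coprod.inr_desc]
  · convert hj
    ext <;> simp [coprod.inl_desc, coprod.inr_desc]

lemma HasRelStrongPath.nonempty {Z Y : C} {p : Z ⟶ Y} (h : P.HasRelStrongPath p) :
    Nonempty (P.RelPath p) := by
  obtain ⟨Q, s, r, fac, hr, hr'⟩ := h
  refine ⟨⟨Q, s, r ≫ pullback.fst p p, r ≫ pullback.snd p p, ?_, ?_, ?_, ?_, hr'⟩⟩
  · rw [reassoc_of% fac, pullback.lift_fst]
  · rw [reassoc_of% fac, pullback.lift_snd]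
  · simp [pullback.condition]
  · convert hr
    ext <;> simp [pullback.lift_fst, pullback.lift_snd]

/-- Two maps out of `B` with the same composite with an acyclic fibration are left homotopic. -/
lemma Cylinder.exists_homotopy {B X Y : C} (I : P.Cylinder B) (hB : P.Cofibrant B) {p : X ⟶ Y}
    (hp : P.acFib p) (f g : B ⟶ X) (h : f ≫ p = g ≫ p) :
    ∃ L : I.I ⟶ X, I.ι₀ ≫ L = f ∧ I.ι₁ ≫ L = g := by
  have hBB := cofibrant_coprod hB hB
  have := hp.2 _ hBB (hBB.of_cof I.cof) I.cof
  have sq : CommSq (coprod.desc f g) (coprod.desc I.ι₀ I.ι₁) p (I.π ≫ f ≫ p) := ⟨by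
    simp [h]⟩
  have hL := sq.fac_left
  generalize sq.lift = L at hL
  refine ⟨L, ?_, ?_⟩
  · rw [← coprod.inl_desc f g, ← hL, coprod.inl_desc_assoc]
  · rw [← coprod.inr_desc f g, ← hL, coprod.inr_desc_assoc]

namespace RelPath

variable {Z Y : C} {p : Z ⟶ Y} (Q : P.RelPath p)

/-- The lifting property against `Q ⟶ Z ×_Y Z`, in terms of the two components. -/
lemma exists_lift {A J : C} {i : A ⟶ J} [HasLiftingProperty i (pullback.lift Q.p₀ Q.p₁ Q.w)]
    (k : A ⟶ Q.Q) (K K' : J ⟶ Z) (h₀ : i ≫ K = k ≫ Q.p₀) (h₁ : i ≫ K' = k ≫ Q.p₁)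
    (hY : K ≫ p = K' ≫ p) : ∃ L : J ⟶ Q.Q, i ≫ L = k ∧ L ≫ Q.p₀ = K ∧ L ≫ Q.p₁ = K' := by
  have sq : CommSq k i (pullback.lift Q.p₀ Q.p₁ Q.w) (pullback.lift K K' hY) := ⟨by
    ext <;> simp [pullback.lift_fst, pullback.lift_snd, h₀, h₁]⟩
  refine ⟨sq.lift, sq.fac_left, ?_, ?_⟩
  · have := sq.fac_right =≫ pullback.fst p p
    rwa [Category.assoc, pullback.lift_fst, pullback.lift_fst] at this
  · have := sq.fac_right =≫ pullback.snd p p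
    rwa [Category.assoc, pullback.lift_snd, pullback.lift_snd] at this

/-- Two maps out of `J` that agree on the domain of an acyclic cofibration `ι : B ⟶ J`, and have
the same projection to `Y`, are homotopic over `Y`. -/
lemma exists_homotopy (hZ : P.Fibrant Z) (hp : P.fib p) {B J : C} {ι : B ⟶ J}
    (hι : P.acCof ι) (K K' : J ⟶ Z) (h : ι ≫ K = ι ≫ K') (hY : K ≫ p = K' ≫ p) :
    ∃ L : J ⟶ Q.Q, L ≫ Q.p₀ = K ∧ L ≫ Q.p₁ = K' := by
  have hfst : P.fib (pullback.fst p p) :=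
    MorphismProperty.of_isPullback (IsPullback.of_hasPullback p p).flip hp
  have hpb : P.Fibrant (pullback p p) := hZ.of_fib hfst
  have := hι.2 _ (hpb.of_fib Q.fib) hpb Q.fib
  -- on `B`, the homotopy is taken to be constant
  obtain ⟨L, -, hL⟩ := Q.exists_lift (i := ι) (ι ≫ K ≫ Q.σ) K K' (by simp) (by simp [h]) hY
  exact ⟨L, hL⟩

end RelPath

/-- An absolute strong path object, as a path object relative to the terminal object. -/
abbrev Path (P : PremodelStructure C) (Z : C) := P.RelPath (terminal.from Z)

variable (P) in
/-- Right homotopy of maps `B ⟶ Z`: there is a homotopy with values in some strong path object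
of `Z`. -/
def RightHomotopic {B Z : C} (f g : B ⟶ Z) : Prop :=
  ∃ (Q : P.Path Z) (k : B ⟶ Q.Q), k ≫ Q.p₀ = f ∧ k ≫ Q.p₁ = g

lemma RightHomotopic.precomp {A B Z : C} {f g : B ⟶ Z} (h : P.RightHomotopic f g) (u : A ⟶ B) :
    P.RightHomotopic (u ≫ f) (u ≫ g) := by
  obtain ⟨Q, k, rfl, rfl⟩ := h
  exact ⟨Q, u ≫ k, by simp, by simp⟩

/-- A homotopy on a cylinder gives a homotopy with values in any given path object. -/
lemma Path.exists_of_cylinder {B Z : C} (Q : P.Path Z) (hZ : P.Fibrant Z) (I : P.Cylinder B)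
    (H : I.I ⟶ Z) : ∃ k : B ⟶ Q.Q, k ≫ Q.p₀ = I.ι₀ ≫ H ∧ k ≫ Q.p₁ = I.ι₁ ≫ H := by
  obtain ⟨L, h₀, h₁⟩ := RelPath.exists_homotopy Q hZ hZ I.acCof (I.π ≫ I.ι₀ ≫ H) H (by simp)
    (by ext)
  exact ⟨I.ι₁ ≫ L, by simp [h₀], by simp [h₁]⟩

/-- Paths with the same starting point have end points that are homotopic on any cylinder. -/
lemma Path.exists_cylinder_homotopy {B Z : C} (Q : P.Path Z) (hB : P.Cofibrant B)
    (I : P.Cylinder B) (k k' : B ⟶ Q.Q) (h : k ≫ Q.p₀ = k' ≫ Q.p₀) :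
    ∃ H : I.I ⟶ Z, I.ι₀ ≫ H = k ≫ Q.p₁ ∧ I.ι₁ ≫ H = k' ≫ Q.p₁ := by
  obtain ⟨L, rfl, rfl⟩ := I.exists_homotopy hB Q.acFib k k' h
  exact ⟨L ≫ Q.p₁, by simp, by simp⟩

lemma RightHomotopic.exists_cylinder_homotopy {B Z : C} {f g : B ⟶ Z}
    (h : P.RightHomotopic f g) (hB : P.Cofibrant B) (I : P.Cylinder B) :
    ∃ H : I.I ⟶ Z, I.ι₀ ≫ H = f ∧ I.ι₁ ≫ H = g := by
  obtain ⟨Q, k, rfl, rfl⟩ := h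
  simpa using Path.exists_cylinder_homotopy Q hB I (k ≫ Q.p₀ ≫ Q.σ) k (by simp)

lemma RightHomotopic.exists_path {B Z : C} {f g : B ⟶ Z}
    (h : P.RightHomotopic f g) (hB : P.Cofibrant B) (hZ : P.Fibrant Z) (I : P.Cylinder B)
    (Q : P.Path Z) : ∃ k : B ⟶ Q.Q, k ≫ Q.p₀ = f ∧ k ≫ Q.p₁ = g := by
  obtain ⟨H, rfl, rfl⟩ := h.exists_cylinder_homotopy hB I
  exact Q.exists_of_cylinder hZ I H

lemma RightHomotopic.postcomp {B Z T : C} {f g : B ⟶ Z} (h : P.RightHomotopic f g)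
    (hB : P.Cofibrant B) (hT : P.Fibrant T) (I : P.Cylinder B) (Q : P.Path T) (u : Z ⟶ T) :
    P.RightHomotopic (f ≫ u) (g ≫ u) := by
  obtain ⟨H, rfl, rfl⟩ := h.exists_cylinder_homotopy hB I
  simpa [RightHomotopic] using ⟨Q, Path.exists_of_cylinder Q hT I (H ≫ u)⟩

/-- Right homotopy is reflexive, and two maps homotopic to the same map are homotopic. -/
lemma rightHomotopic_equivalence {B Z : C} (hB : P.Cofibrant B) (hZ : P.Fibrant Z)
    (I : P.Cylinder B) (Q : P.Path Z) :
    Equivalence (P.RightHomotopic : (B ⟶ Z) → (B ⟶ Z) → Prop) := by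
  have refl (f : B ⟶ Z) : P.RightHomotopic f f := ⟨Q, f ≫ Q.σ, by simp, by simp⟩
  have eucl {f g h : B ⟶ Z} (hg : P.RightHomotopic f g) (hh : P.RightHomotopic f h) :
      P.RightHomotopic g h := by
    obtain ⟨k, hk, rfl⟩ := hg.exists_path hB hZ I Q
    obtain ⟨k', hk', rfl⟩ := hh.exists_path hB hZ I Q
    obtain ⟨H, h₀, h₁⟩ := Path.exists_cylinder_homotopy Q hB I k k' (hk.trans hk'.symm)
    rw [← h₀, ← h₁]
    exact ⟨Q, Q.exists_of_cylinder hZ I H⟩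
  exact ⟨refl, fun h => eucl h (refl _), fun h h' => eucl (eucl h (refl _)) h'⟩

lemma IsWeakModel.nonempty_path (hw : P.IsWeakModel) {Z : C} (hZ : P.Cofibrant Z)
    (hZ' : P.Fibrant Z) : Nonempty (P.Path Z) :=
  (hw.path (terminal.from Z) hZ
    ((fibrant_iff_of_isTerminal terminalIsTerminal (𝟙 _)).2 (P.fib.id_mem _)) hZ').nonempty

/-! ### Homotopy classes and homotopy equivalences -/

variable (P) in
/-- Homotopy classes of maps `B ⟶ Z`. The relation of right homotopy is an equivalence relation
if `B` is cofibrant with a strong cylinder object and `Z` is fibrant with a strong path object. -/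
def HoClasses (B Z : C) : Type v := Quot (P.RightHomotopic : (B ⟶ Z) → (B ⟶ Z) → Prop)

/-- Precomposition with a map, on homotopy classes. -/
def HoClasses.precomp {A B : C} (f : A ⟶ B) (Z : C) : P.HoClasses B Z → P.HoClasses A Z :=
  Quot.map (fun u => f ≫ u) fun _ _ h => h.precomp f

lemma HoClasses.precomp_id (B Z : C) : (precomp (𝟙 B) Z : P.HoClasses B Z → _) = id := by
  funext u
  induction u using Quot.ind with | mk u
  exact congrArg _ (Category.id_comp u)

lemma HoClasses.precomp_comp {A B D : C} (f : A ⟶ B) (g : B ⟶ D) (Z : C) :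
    (precomp (f ≫ g) Z : P.HoClasses D Z → _) = precomp f Z ∘ precomp g Z := by
  funext u
  induction u using Quot.ind with | mk u
  exact congrArg _ (Category.assoc f g u)

variable (P) in
/-- A map inducing bijections on homotopy classes of maps to all bifibrant objects. -/
def IsHoEquiv {A B : C} (f : A ⟶ B) : Prop :=
  ∀ ⦃Z : C⦄, P.Cofibrant Z → P.Fibrant Z →
    Function.Bijective (HoClasses.precomp f Z : P.HoClasses B Z → P.HoClasses A Z)

lemma IsHoEquiv.comp {A B D : C} {f : A ⟶ B} {g : B ⟶ D} (hf : P.IsHoEquiv f)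
    (hg : P.IsHoEquiv g) : P.IsHoEquiv (f ≫ g) := by
  intro Z hZ hZ'
  rw [HoClasses.precomp_comp]
  exact (hf hZ hZ').comp (hg hZ hZ')

lemma IsHoEquiv.comp_iff_right {A B D : C} {f : A ⟶ B} (hf : P.IsHoEquiv f) (g : B ⟶ D) :
    P.IsHoEquiv (f ≫ g) ↔ P.IsHoEquiv g := by
  refine ⟨fun h Z hZ hZ' => ?_, hf.comp⟩
  have := h hZ hZ'
  rwa [HoClasses.precomp_comp, (hf hZ hZ').of_comp_iff'] at this

lemma IsHoEquiv.comp_iff_left {A B D : C} (f : A ⟶ B) {g : B ⟶ D} (hg : P.IsHoEquiv g) :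
    P.IsHoEquiv (f ≫ g) ↔ P.IsHoEquiv f := by
  refine ⟨fun h Z hZ hZ' => ?_, fun hf => hf.comp hg⟩
  have := h hZ hZ'
  rwa [HoClasses.precomp_comp, Function.Bijective.of_comp_iff _ (hg hZ hZ')] at this

variable (hw : P.IsWeakModel) (hc : ∀ X : C, P.Cofibrant X → P.HasStrongCylinder X)

include hw hc

lemma equivalence_rightHomotopic {B Z : C} (hB : P.Cofibrant B) (hZ : P.Cofibrant Z)
    (hZ' : P.Fibrant Z) : Equivalence (P.RightHomotopic : (B ⟶ Z) → (B ⟶ Z) → Prop) :=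
  let ⟨I⟩ := (hc B hB).nonempty
  let ⟨Q⟩ := hw.nonempty_path hZ hZ'
  rightHomotopic_equivalence hB hZ' I Q

lemma HoClasses.mk_eq_mk_iff {B Z : C} (hB : P.Cofibrant B) (hZ : P.Cofibrant Z)
    (hZ' : P.Fibrant Z) (f g : B ⟶ Z) :
    (Quot.mk _ f : P.HoClasses B Z) = Quot.mk _ g ↔ P.RightHomotopic f g := by
  rw [Quot.eq, (equivalence_rightHomotopic hw hc hB hZ hZ').eqvGen_iff]

/-- Two lifts of the same map along an acyclic fibration are left homotopic, and therefore have the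
same effect on homotopy classes. -/
lemma HoClasses.precomp_eq_of_acFib {A B Y Z : C} (hA : P.Cofibrant A) (hZ : P.Cofibrant Z)
    (hZ' : P.Fibrant Z) {u v : A ⟶ B} {e : B ⟶ Y} (he : P.acFib e) (h : u ≫ e = v ≫ e) :
    (precomp u Z : P.HoClasses B Z → P.HoClasses A Z) = precomp v Z := by
  obtain ⟨I⟩ := (hc A hA).nonempty
  obtain ⟨Q⟩ := hw.nonempty_path hZ hZ'
  obtain ⟨L, rfl, rfl⟩ := I.exists_homotopy hA he u v h
  funext f
  induction f using Quot.ind with | mk f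
  refine Quot.sound ⟨Q, ?_⟩
  simpa using Path.exists_of_cylinder Q hZ' I (L ≫ f)

/-- A map between cofibrant replacements of the same object is a homotopy equivalence. -/
lemma isHoEquiv_of_anFib {A B Y : C} (hA : P.Cofibrant A) (hB : P.Cofibrant B) {p : A ⟶ Y}
    {q : B ⟶ Y} (hp : P.anFib p) (hq : P.anFib q) (f : A ⟶ B) (hf : f ≫ q = p) :
    P.IsHoEquiv f := by
  intro Z hZ hZ'
  obtain ⟨s, hs⟩ := hB.exists_lift_anFib hp q
  refine Function.bijective_iff_has_inverse.2 ⟨HoClasses.precomp s Z, ?_, ?_⟩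
  · rw [Function.leftInverse_iff_comp, ← HoClasses.precomp_comp, ← HoClasses.precomp_id]
    exact HoClasses.precomp_eq_of_acFib hw hc hB hZ hZ' (anFib_le_acFib _ hq) (by simp [hf, hs])
  · rw [Function.rightInverse_iff_comp, ← HoClasses.precomp_comp, ← HoClasses.precomp_id]
    exact HoClasses.precomp_eq_of_acFib hw hc hA hZ hZ' (anFib_le_acFib _ hp) (by simp [hf, hs])

lemma isHoEquiv_of_anCof {A B : C} (hA : P.Cofibrant A) {i : A ⟶ B}
    (hi : P.anCof i) : P.IsHoEquiv i := by
  have hB := hA.of_cof (P.anCof_le_cof _ hi)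
  intro Z hZ hZ'
  constructor
  · rintro ⟨f⟩ ⟨g⟩ hfg
    obtain ⟨Q, k, h₀, h₁⟩ := (HoClasses.mk_eq_mk_iff hw hc hA hZ hZ' _ _).1 hfg
    have := hasLiftingProperty_anCof_fib hi Q.fib
    obtain ⟨L, -, hL⟩ := RelPath.exists_lift Q k f g h₀.symm h₁.symm (by ext)
    exact Quot.sound ⟨Q, L, hL⟩
  · rintro ⟨f⟩
    obtain ⟨g, rfl⟩ := hZ'.exists_extension_anCof hi f
    exact ⟨Quot.mk _ g, rfl⟩

end PremodelStructure

namespace PremodelStructure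

variable {C : Type u} [Category.{v} C] [HasLimits C] [HasColimits C] {P : PremodelStructure C}

section

variable (hw : P.IsWeakModel) (hc : ∀ X : C, P.Cofibrant X → P.HasStrongCylinder X)

include hw hc

/-! ### Fibrations and cofibrations that are homotopy equivalences -/

/-- A fibration between bifibrant objects that is a homotopy equivalence has a section that is
also a homotopy inverse. -/
lemma IsHoEquiv.exists_section {Z B : C} {q : Z ⟶ B} (h : P.IsHoEquiv q) (hq : P.fib q)
    (hZ : P.Cofibrant Z) (hB : P.Cofibrant B) (hB' : P.Fibrant B) :
    ∃ s : B ⟶ Z, s ≫ q = 𝟙 B ∧ P.RightHomotopic (q ≫ s) (𝟙 Z) := by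
  have hZ' : P.Fibrant Z := hB'.of_fib hq
  obtain ⟨I⟩ := (hc B hB).nonempty
  obtain ⟨J⟩ := (hc Z hZ).nonempty
  obtain ⟨QB⟩ := hw.nonempty_path hB hB'
  obtain ⟨QZ⟩ := hw.nonempty_path hZ hZ'
  obtain ⟨⟨s⟩, hs⟩ := (h hZ hZ').surjective (Quot.mk _ (𝟙 Z))
  have hs₁ : P.RightHomotopic (q ≫ s) (𝟙 Z) :=
    (HoClasses.mk_eq_mk_iff hw hc hZ hZ hZ' _ _).1 hs
  have hs₂ : P.RightHomotopic (s ≫ q) (𝟙 B) := by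
    rw [← HoClasses.mk_eq_mk_iff hw hc hB hB hB']
    refine (h hB hB').injective (Quot.sound ?_)
    simpa using hs₁.postcomp hZ hB' J QB q
  -- Lifting this homotopy along `q`, starting at `s`, replaces `s` by a strict section.
  obtain ⟨H, h₀, h₁⟩ := hs₂.exists_cylinder_homotopy hB I
  have := I.acCof.2 q hZ' hB' hq
  have sq : CommSq s I.ι₀ q H := ⟨h₀.symm⟩
  refine ⟨I.ι₁ ≫ sq.lift, by simp [h₁], ?_⟩
  have hs₃ : P.RightHomotopic s (I.ι₁ ≫ sq.lift) := by
    have hk := Path.exists_of_cylinder QZ hZ' I sq.lift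
    rw [sq.fac_left] at hk
    exact ⟨QZ, hk⟩
  have E := equivalence_rightHomotopic hw hc hZ hZ hZ'
  exact E.trans (E.symm (hs₃.precomp q)) hs₁

/-- For a section `s` that is a homotopy inverse of `q`, and a homotopy `H` from `q ≫ s` to the
identity, the homotopies `H` and `H ≫ q ≫ s` both start at `q ≫ s` and have the same projection
along `q`. They are therefore homotopic over `B`, and at the end points this is a homotopy over `B`
between `q ≫ s` and the identity. It deforms the evident solution of a lifting problem against `q`,
given by `s`, which commutes only up to homotopy, to a strict solution. -/
lemma IsHoEquiv.acFib {Z B : C} {q : Z ⟶ B} (h : P.IsHoEquiv q) (hq : P.fib q)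
    (hZ : P.Cofibrant Z) (hB : P.Cofibrant B) (hB' : P.Fibrant B) : P.acFib q := by
  obtain ⟨s, hs, hs'⟩ := h.exists_section hw hc hq hZ hB hB'
  obtain ⟨J⟩ := (hc Z hZ).nonempty
  obtain ⟨R⟩ := (hw.path q hZ hB' hq).nonempty
  obtain ⟨H, h₀, h₁⟩ := hs'.exists_cylinder_homotopy hZ J
  obtain ⟨L, hL₀, hL₁⟩ := R.exists_homotopy (hB'.of_fib hq) hq J.acCof (H ≫ q ≫ s) H
    (by simp [reassoc_of% h₀, reassoc_of% hs, h₀]) (by simp [hs])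
  obtain ⟨k, hk₀, hk₁⟩ : ∃ k : Z ⟶ R.Q, k ≫ R.p₀ = q ≫ s ∧ k ≫ R.p₁ = 𝟙 Z :=
    ⟨J.ι₁ ≫ L, by simp [hL₀, reassoc_of% h₁], by simp [hL₁, h₁]⟩
  refine ⟨hq, fun A D i hA hD hi => ⟨fun {u w} sq => ?_⟩⟩
  have := R.acFib.2 i hA hD hi
  have sq' : CommSq (u ≫ k) i R.p₀ (w ≫ s) := ⟨by
    rw [Category.assoc, hk₀, reassoc_of% sq.w]⟩
  refine ⟨⟨sq'.lift ≫ R.p₁, ?_, ?_⟩⟩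
  · rw [reassoc_of% sq'.fac_left, hk₁, Category.comp_id]
  · rw [Category.assoc, ← R.w, reassoc_of% sq'.fac_right, hs, Category.comp_id]

/-- After composition with a fibrant replacement of the codomain, a core cofibration `i` that is a
homotopy equivalence factors as an anodyne cofibration followed by an acyclic fibration. Lifts
against fibrations between fibrant objects exist for the former, and transfer to `i` by the
lifting property of `i` against the latter. -/
lemma IsHoEquiv.acCof {A B : C} {i : A ⟶ B} (h : P.IsHoEquiv i) (hA : P.Cofibrant A)
    (hi : P.cof i) : P.acCof i := by
  have hB := hA.of_cof hi
  obtain ⟨B', j, hj, hB'⟩ := P.exists_fibrant_replacement B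
  obtain ⟨Z, c, q, fac, hc', hq⟩ := P.exists_anCof_fib (i ≫ j)
  have hZ := hA.of_cof (P.anCof_le_cof _ hc')
  have hq' : P.IsHoEquiv q := by
    rw [← (isHoEquiv_of_anCof hw hc hA hc').comp_iff_right, fac]
    exact h.comp (isHoEquiv_of_anCof hw hc hB hj)
  have := (hq'.acFib hw hc hq hZ (hB.of_cof (P.anCof_le_cof _ hj)) hB').2 i hA hB hi
  have sq : CommSq c i q j := ⟨fac⟩
  refine ⟨hi, fun X Y p hX hY hp => ⟨fun {a b} sq' => ?_⟩⟩
  obtain ⟨b', hb⟩ := hY.exists_extension_anCof hj b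
  have := hasLiftingProperty_anCof_fib hc' hp
  have sq'' : CommSq a c p (q ≫ b') := ⟨by rw [reassoc_of% fac, hb, sq'.w]⟩
  refine ⟨⟨sq.lift ≫ sq''.lift, ?_, ?_⟩⟩
  · rw [reassoc_of% sq.fac_left, sq''.fac_left]
  · rw [Category.assoc, sq''.fac_right, reassoc_of% sq.fac_right, hb]

end

/-! ### The weak equivalences -/

section

variable (P)

/-- A chosen cofibrant replacement. -/
noncomputable def cofRepl (X : C) : C := (P.exists_cofibrant_replacement X).choose

/-- The anodyne fibration from the chosen cofibrant replacement. -/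
noncomputable def cofReplπ (X : C) : P.cofRepl X ⟶ X :=
  (P.exists_cofibrant_replacement X).choose_spec.choose

lemma anFib_cofReplπ (X : C) : P.anFib (P.cofReplπ X) :=
  (P.exists_cofibrant_replacement X).choose_spec.choose_spec.1

lemma cofibrant_cofRepl (X : C) : P.Cofibrant (P.cofRepl X) :=
  (P.exists_cofibrant_replacement X).choose_spec.choose_spec.2

/-- A chosen lift of a map to cofibrant replacements; it is functorial only up to homotopy. -/
noncomputable def cofReplMap {X Y : C} (f : X ⟶ Y) : P.cofRepl X ⟶ P.cofRepl Y :=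
  ((P.cofibrant_cofRepl X).exists_lift_anFib (P.anFib_cofReplπ Y) (P.cofReplπ X ≫ f)).choose

lemma cofReplMap_π {X Y : C} (f : X ⟶ Y) :
    P.cofReplMap f ≫ P.cofReplπ Y = P.cofReplπ X ≫ f :=
  ((P.cofibrant_cofRepl X).exists_lift_anFib (P.anFib_cofReplπ Y) (P.cofReplπ X ≫ f)).choose_spec

/-- The maps that become homotopy equivalences on cofibrant replacements. -/
def leftWeq : MorphismProperty C := fun _ _ f => P.IsHoEquiv (P.cofReplMap f)

end

section

variable (hw : P.IsWeakModel) (hc : ∀ X : C, P.Cofibrant X → P.HasStrongCylinder X)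

/-- Homotopy classes of maps from cofibrant replacements to a fixed bifibrant object, as a
contravariant functor. -/
noncomputable def hoFunctor {Z : C} (hZ : P.Cofibrant Z) (hZ' : P.Fibrant Z) : C ⥤ (Type v)ᵒᵖ where
  obj X := .op (P.HoClasses (P.cofRepl X) Z)
  map f := (TypeCat.ofHom (HoClasses.precomp (P.cofReplMap f) Z)).op
  map_id X := by
    rw [HoClasses.precomp_eq_of_acFib hw hc (v := 𝟙 _) (P.cofibrant_cofRepl X) hZ hZ'
      (anFib_le_acFib _ (P.anFib_cofReplπ X)) (by simp [cofReplMap_π]), HoClasses.precomp_id]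
    rfl
  map_comp {X Y T} f g := by
    rw [HoClasses.precomp_eq_of_acFib hw hc (v := P.cofReplMap f ≫ P.cofReplMap g)
      (P.cofibrant_cofRepl X) hZ hZ' (anFib_le_acFib _ (P.anFib_cofReplπ T))
      (by simp [cofReplMap_π, reassoc_of% P.cofReplMap_π f]), HoClasses.precomp_comp]
    rfl

lemma leftWeq_iff {X Y : C} (f : X ⟶ Y) :
    P.leftWeq f ↔ ∀ ⦃Z : C⦄ (hZ : P.Cofibrant Z) (hZ' : P.Fibrant Z),
      (MorphismProperty.isomorphisms _).inverseImage (hoFunctor hw hc hZ hZ') f := by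
  refine forall₃_congr fun Z hZ hZ' => ?_
  change _ ↔ IsIso (TypeCat.ofHom _).op
  rw [isIso_op_iff, bijective_iff_isIso_ofHom]

include hw hc

lemma leftWeq_hasTwoOutOfThreeProperty : P.leftWeq.HasTwoOutOfThreeProperty where
  comp_mem f g hf hg := by
    rw [leftWeq_iff hw hc] at hf hg ⊢
    exact fun Z hZ hZ' => MorphismProperty.comp_mem _ f g (hf hZ hZ') (hg hZ hZ')
  of_postcomp f g hg hfg := by
    rw [leftWeq_iff hw hc] at hg hfg ⊢
    exact fun Z hZ hZ' => MorphismProperty.of_postcomp _ f g (hg hZ hZ') (hfg hZ hZ')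
  of_precomp f g hf hfg := by
    rw [leftWeq_iff hw hc] at hf hfg ⊢
    exact fun Z hZ hZ' => MorphismProperty.of_precomp _ f g (hf hZ hZ') (hfg hZ hZ')

lemma leftWeq_isStableUnderRetracts : P.leftWeq.IsStableUnderRetracts where
  of_retract r hg := by
    rw [leftWeq_iff hw hc] at hg ⊢
    exact fun Z hZ hZ' => MorphismProperty.of_retract r (hg hZ hZ')

lemma leftWeq_of_anFib {X Y : C} {p : X ⟶ Y} (hp : P.anFib p) : P.leftWeq p :=
  isHoEquiv_of_anFib hw hc (P.cofibrant_cofRepl X) (P.cofibrant_cofRepl Y)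
    (P.anFib.comp_mem _ _ (P.anFib_cofReplπ X) hp) (P.anFib_cofReplπ Y) _ (P.cofReplMap_π p)

lemma leftWeq_iff_isHoEquiv {A B : C} (hA : P.Cofibrant A) (hB : P.Cofibrant B) (f : A ⟶ B) :
    P.leftWeq f ↔ P.IsHoEquiv f := by
  have key : ∀ {X : C}, P.Cofibrant X → P.IsHoEquiv (P.cofReplπ X) := fun {X} hX =>
    isHoEquiv_of_anFib hw hc (P.cofibrant_cofRepl X) hX (P.anFib_cofReplπ X)
      (P.anFib.id_mem X) _ (Category.comp_id _)
  rw [← (key hA).comp_iff_right, ← cofReplMap_π, (key hB).comp_iff_left]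
  rfl

lemma leftWeq_of_anCof {A B : C} (hA : P.Cofibrant A) {i : A ⟶ B} (hi : P.anCof i) :
    P.leftWeq i :=
  (leftWeq_iff_isHoEquiv hw hc hA (hA.of_cof (P.anCof_le_cof _ hi)) i).2
    (isHoEquiv_of_anCof hw hc hA hi)

lemma anCof_of_leftWeq (hs : P.CoreLeftSaturated) {A B : C} (hA : P.Cofibrant A) {i : A ⟶ B}
    (hi : P.cof i) (hW : P.leftWeq i) : P.anCof i :=
  hs i hA (((leftWeq_iff_isHoEquiv hw hc hA (hA.of_cof hi) i).1 hW).acCof hw hc hA hi)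

/-- A fibration with cofibrant domain that is a weak equivalence is a retract of the anodyne
fibration in a factorization. -/
lemma anFib_of_leftWeq (hs : P.CoreLeftSaturated) {X Y : C} (hX : P.Cofibrant X) {p : X ⟶ Y}
    (hp : P.fib p) (hW : P.leftWeq p) : P.anFib p := by
  have := leftWeq_hasTwoOutOfThreeProperty hw hc
  obtain ⟨Z, j, t, fac, hj, ht⟩ := P.exists_cof_anFib p
  have hj' : P.anCof j := anCof_of_leftWeq hw hc hs hX hj
    (P.leftWeq.of_postcomp j t (leftWeq_of_anFib hw hc ht) (fac ▸ hW))
  have := hasLiftingProperty_anCof_fib hj' hp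
  exact P.anFib.of_retract (RetractArrow.ofRightLiftingProperty fac) ht

theorem isFresseLeftSemiModel_leftWeq (hs : P.CoreLeftSaturated) :
    IsFresseLeftSemiModel P.leftWeq P.cof P.fib where
  two_out_of_three := leftWeq_hasTwoOutOfThreeProperty hw hc
  retract_W := leftWeq_isStableUnderRetracts hw hc
  retract_cof := inferInstance
  retract_fib := inferInstance
  fact_cof_trivFib X Y f _ := by
    obtain ⟨Z, i, p, fac, hi, hp⟩ := P.exists_cof_anFib f
    exact ⟨Z, i, p, fac, hi, anFib_le_fib _ hp, leftWeq_of_anFib hw hc hp⟩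
  fact_trivCof_fib X Y f hX := by
    obtain ⟨Z, i, p, fac, hi, hp⟩ := P.exists_anCof_fib f
    exact ⟨Z, i, p, fac, P.anCof_le_cof _ hi, leftWeq_of_anCof hw hc hX hi, hp⟩
  lift A B X Y i p hA hi hp hW := by
    obtain hW | hW := hW
    · exact hasLiftingProperty_anCof_fib (anCof_of_leftWeq hw hc hs hA hi hW) hp
    · -- Since `A` is cofibrant, `X` can be replaced by a cofibrant object.
      have := leftWeq_hasTwoOutOfThreeProperty hw hc
      obtain ⟨X', e, he, hX'⟩ := P.exists_cofibrant_replacement X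
      have := hasLiftingProperty_cof_anFib hi (anFib_of_leftWeq hw hc hs hX'
        (P.fib.comp_mem _ _ (anFib_le_fib _ he) hp)
        (P.leftWeq.comp_mem _ _ (leftWeq_of_anFib hw hc he) hW))
      refine ⟨fun {u w} sq => ?_⟩
      obtain ⟨u', hu⟩ := Cofibrant.exists_lift_anFib hA he u
      have sq' : CommSq u' i (e ≫ p) w := ⟨by rw [reassoc_of% hu, sq.w]⟩
      exact ⟨⟨sq'.lift ≫ e, by rw [reassoc_of% sq'.fac_left, hu],
        by rw [Category.assoc, sq'.fac_right]⟩⟩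
  pullback_fib := inferInstance
  cofibrant_initial := PremodelStructure.cofibrant_initial

end

end PremodelStructure

/-! ### Left semi-model categories -/

namespace PremodelStructure

variable {C : Type u} [Category.{v} C] [HasLimits C] [HasColimits C] (P : PremodelStructure C)

/-- The conditions characterizing Fresse left semi-model categories. -/
def IsLeftSemi : Prop :=
  P.IsWeakModel ∧ (∀ X : C, P.Cofibrant X → P.HasStrongCylinder X) ∧ P.CoreLeftSaturated

/-- The conditions characterizing Fresse right semi-model categories. -/
def IsRightSemi : Prop :=
  P.IsWeakModel ∧ (∀ X : C, P.Fibrant X → P.HasStrongPath X) ∧ P.CoreRightSaturated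

theorem left_semiModel :
    ((∃ W : MorphismProperty C, IsFresseLeftSemiModel W P.cof P.fib) ↔ P.IsLeftSemi) ∧
    (P.IsLeftSemi → ∃! W : MorphismProperty C, IsFresseLeftSemiModel W P.cof P.fib) ∧
    ((∃ W : MorphismProperty C, IsSpitzweckLeftSemiModel W P.cof P.fib) ↔
      (P.IsLeftSemi ∧ P.RightSaturated)) ∧
    (∀ W : MorphismProperty C, IsFresseLeftSemiModel W P.cof P.fib →
      (IsSpitzweckLeftSemiModel W P.cof P.fib ↔ P.RightSaturated)) := by
  have h₁ {W : MorphismProperty C} (h : IsFresseLeftSemiModel W P.cof P.fib) : P.IsLeftSemi :=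
    ⟨h.isWeakModel, fun _ hX => h.hasStrongCylinder hX, h.coreLeftSaturated⟩
  have h₂ (h : P.IsLeftSemi) : IsFresseLeftSemiModel P.leftWeq P.cof P.fib :=
    isFresseLeftSemiModel_leftWeq h.1 h.2.1 h.2.2
  refine ⟨⟨fun ⟨W, h⟩ => h₁ h, fun h => ⟨_, h₂ h⟩⟩,
    fun h => ⟨_, h₂ h, fun W hW => le_antisymm (hW.le (h₂ h)) ((h₂ h).le hW)⟩,
    ⟨fun ⟨W, h⟩ => ⟨h₁ h.toIsFresseLeftSemiModel, h.isSpitzweck_iff.1 h⟩,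
      fun h => ⟨_, (h₂ h.1).isSpitzweck_iff.2 h.2⟩⟩,
    fun W h => h.isSpitzweck_iff⟩

/-! ### Duality -/

lemma isWeakFactorizationSystem_op {L R : MorphismProperty C}
    (h : L.IsWeakFactorizationSystem R) : R.op.IsWeakFactorizationSystem L.op where
  rlp := by
    ext X Y f
    refine ⟨fun hf => ?_, fun hf A B i hi => ?_⟩
    · change L f.unop
      rw [← h.llp]
      exact fun _ _ p hp => HasLiftingProperty.iff_op.2 (hf p.op hp)
    · exact (HasLiftingProperty.iff_unop _ _).2
        (MorphismProperty.hasLiftingProperty_of_wfs _ _ hf hi)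
  llp := by
    ext X Y f
    refine ⟨fun hf => ?_, fun hf A B i hi => ?_⟩
    · change R f.unop
      rw [← h.rlp]
      exact fun _ _ p hp => HasLiftingProperty.iff_op.2 (hf p.op hp)
    · exact (HasLiftingProperty.iff_unop _ _).2
        (MorphismProperty.hasLiftingProperty_of_wfs _ _ hi hf)
  hasFactorization := ⟨fun f => ⟨(L.factorizationData R f.unop).op⟩⟩

lemma isWeakFactorizationSystem_unop {L R : MorphismProperty Cᵒᵖ}
    (h : L.IsWeakFactorizationSystem R) : R.unop.IsWeakFactorizationSystem L.unop where
  rlp := by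
    ext X Y f
    refine ⟨fun hf => ?_, fun hf A B i hi => ?_⟩
    · change L f.op
      rw [← h.llp]
      exact fun _ _ p hp => (HasLiftingProperty.iff_unop _ _).2 (hf p.unop hp)
    · exact HasLiftingProperty.iff_op.2
        (MorphismProperty.hasLiftingProperty_of_wfs _ _ hf hi)
  llp := by
    ext X Y f
    refine ⟨fun hf => ?_, fun hf A B i hi => ?_⟩
    · change R f.op
      rw [← h.rlp]
      exact fun _ _ p hp => (HasLiftingProperty.iff_unop _ _).2 (hf p.unop hp)
    · exact HasLiftingProperty.iff_op.2
        (MorphismProperty.hasLiftingProperty_of_wfs _ _ hi hf)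
  hasFactorization := ⟨fun f => by
    let d := L.factorizationData R f.op
    exact ⟨⟨d.Z.unop, d.p.unop, d.i.unop, Quiver.Hom.op_inj (by simp), d.hp, d.hi⟩⟩⟩

/-- The opposite of a premodel structure. -/
def op : PremodelStructure Cᵒᵖ where
  cof := P.fib.op
  anFib := P.anCof.op
  anCof := P.anFib.op
  fib := P.cof.op
  wfs_cof_anFib := isWeakFactorizationSystem_op P.wfs_anCof_fib
  wfs_anCof_fib := isWeakFactorizationSystem_op P.wfs_cof_anFib
  anCof_le_cof _ _ _ hi := anFib_le_fib _ hi

lemma op_cofibrant_iff (X : C) : P.op.Cofibrant (.op X) ↔ P.Fibrant X :=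
  cofibrant_iff_of_isInitial (P := P.op) (initialOpOfTerminal terminalIsTerminal)
    (terminal.from X).op

lemma op_fibrant_iff (X : C) : P.op.Fibrant (.op X) ↔ P.Cofibrant X :=
  fibrant_iff_of_isTerminal (P := P.op) (terminalOpOfInitial initialIsInitial)
    (initial.to X).op

lemma op_acCof_iff {X Y : C} (p : X ⟶ Y) : P.op.acCof p.op ↔ P.acFib p := by
  refine and_congr Iff.rfl ⟨fun h A B i hA hB hi => ?_, fun h X Y i hX hY hi => ?_⟩
  · exact HasLiftingProperty.iff_op.2
      (h i.op ((P.op_fibrant_iff B).2 hB) ((P.op_fibrant_iff A).2 hA) hi)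
  · exact (HasLiftingProperty.iff_unop _ _).2
      (h i.unop ((P.op_fibrant_iff _).1 hY) ((P.op_fibrant_iff _).1 hX) hi)

lemma op_acFib_iff {X Y : C} (i : X ⟶ Y) : P.op.acFib i.op ↔ P.acCof i := by
  refine and_congr Iff.rfl ⟨fun h A B p hA hB hp => ?_, fun h X Y p hX hY hp => ?_⟩
  · exact HasLiftingProperty.iff_op.2
      (h p.op ((P.op_cofibrant_iff B).2 hB) ((P.op_cofibrant_iff A).2 hA) hp)
  · exact (HasLiftingProperty.iff_unop _ _).2
      (h p.unop ((P.op_cofibrant_iff _).1 hY) ((P.op_cofibrant_iff _).1 hX) hp)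

lemma op_coreLeftSaturated_iff : P.op.CoreLeftSaturated ↔ P.CoreRightSaturated :=
  ⟨fun h _ _ p hY hp => h p.op ((P.op_cofibrant_iff _).2 hY) ((P.op_acCof_iff p).2 hp),
    fun h _ _ i hA hi => h i.unop ((P.op_cofibrant_iff _).1 hA) ((P.op_acCof_iff i.unop).1 hi)⟩

lemma op_rightSaturated_iff : P.op.RightSaturated ↔ P.LeftSaturated :=
  ⟨fun h _ _ i hi => h i.op ((P.op_acFib_iff i).2 hi),
    fun h _ _ p hp => h p.unop ((P.op_acFib_iff p.unop).1 hp)⟩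

lemma op_hasRelStrongCylinder_iff {A X : C} (p : A ⟶ X) :
    P.op.HasRelStrongCylinder p.op ↔ P.HasRelStrongPath p := by
  have h := IsPullback.of_hasPullback p p
  rw [hasRelStrongCylinder_iff h.op.flip, hasRelStrongPath_iff h]
  constructor
  · rintro ⟨I, j, q, ha, hb, hj, hj'⟩
    exact ⟨I.unop, q.unop, j.unop, Quiver.Hom.op_inj (by simpa using ha),
      Quiver.Hom.op_inj (by simpa using hb), hj, (P.op_acCof_iff _).1 hj'⟩
  · rintro ⟨Q, s, r, ha, hb, hr, hr'⟩
    exact ⟨.op Q, r.op, s.op, Quiver.Hom.unop_inj (by simpa using ha),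
      Quiver.Hom.unop_inj (by simpa using hb), hr, (P.op_acCof_iff _).2 hr'⟩

lemma op_hasRelStrongPath_iff {A X : C} (i : A ⟶ X) :
    P.op.HasRelStrongPath i.op ↔ P.HasRelStrongCylinder i := by
  have h := IsPushout.of_hasPushout i i
  rw [hasRelStrongPath_iff h.op.flip, hasRelStrongCylinder_iff h]
  constructor
  · rintro ⟨Q, s, r, ha, hb, hr, hr'⟩
    exact ⟨Q.unop, r.unop, s.unop, Quiver.Hom.op_inj (by simpa using ha),
      Quiver.Hom.op_inj (by simpa using hb), hr, (P.op_acFib_iff _).1 hr'⟩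
  · rintro ⟨I, j, q, ha, hb, hj, hj'⟩
    exact ⟨.op I, q.op, j.op, Quiver.Hom.unop_inj (by simpa using ha),
      Quiver.Hom.unop_inj (by simpa using hb), hj, (P.op_acFib_iff _).2 hj'⟩

lemma op_hasStrongCylinder_iff (X : C) :
    P.op.HasStrongCylinder (.op X) ↔ P.HasStrongPath X := by
  have h := prodIsProd X X
  rw [hasStrongCylinder_iff (BinaryFan.IsLimit.op h), hasStrongPath_iff h]
  constructor
  · rintro ⟨I, j, q, ha, hb, hj, hj'⟩
    exact ⟨I.unop, q.unop, j.unop, Quiver.Hom.op_inj (by simpa using ha),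
      Quiver.Hom.op_inj (by simpa using hb), hj, (P.op_acCof_iff _).1 hj'⟩
  · rintro ⟨Q, s, r, ha, hb, hr, hr'⟩
    exact ⟨.op Q, r.op, s.op, Quiver.Hom.unop_inj (by simpa using ha),
      Quiver.Hom.unop_inj (by simpa using hb), hr, (P.op_acCof_iff _).2 hr'⟩

lemma op_isWeakModel_iff : P.op.IsWeakModel ↔ P.IsWeakModel := by
  constructor
  · exact fun h =>
      ⟨fun A X i hA hX hi => (P.op_hasRelStrongPath_iff i).1
        (h.path i.op ((P.op_cofibrant_iff X).2 hX) ((P.op_fibrant_iff A).2 hA) hi),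
      fun A X p hA hX hp => (P.op_hasRelStrongCylinder_iff p).1
        (h.cylinder p.op ((P.op_cofibrant_iff X).2 hX) ((P.op_fibrant_iff A).2 hA) hp)⟩
  · exact fun h =>
      ⟨fun A X i hA hX hi => (P.op_hasRelStrongCylinder_iff i.unop).2
        (h.path i.unop ((P.op_fibrant_iff _).1 hX) ((P.op_cofibrant_iff _).1 hA) hi),
      fun A X p hA hX hp => (P.op_hasRelStrongPath_iff p.unop).2
        (h.cylinder p.unop ((P.op_fibrant_iff _).1 hX) ((P.op_cofibrant_iff _).1 hA) hp)⟩

lemma op_isLeftSemi_iff : P.op.IsLeftSemi ↔ P.IsRightSemi := by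
  refine and_congr P.op_isWeakModel_iff (and_congr ⟨fun h X hX => ?_, fun h X hX => ?_⟩
    P.op_coreLeftSaturated_iff)
  · exact (P.op_hasStrongCylinder_iff X).1 (h _ ((P.op_cofibrant_iff X).2 hX))
  · exact (P.op_hasStrongCylinder_iff X.unop).2 (h _ ((P.op_cofibrant_iff X.unop).1 hX))

lemma op_isFresseLeftSemiModel_iff (W : MorphismProperty C) :
    IsFresseLeftSemiModel W.op P.op.cof P.op.fib ↔ IsFresseRightSemiModel W P.cof P.fib := by
  constructor
  · intro h
    have := h.two_out_of_three
    have := h.retract_W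
    exact
    { two_out_of_three := inferInstanceAs W.op.unop.HasTwoOutOfThreeProperty
      retract_W := inferInstanceAs W.op.unop.IsStableUnderRetracts
      retract_cof := inferInstance
      retract_fib := inferInstance
      fact_cof_trivFib := fun X Y f hY => by
        obtain ⟨Z, i, p, fac, hi, hW, hp⟩ :=
          h.fact_trivCof_fib f.op ((P.op_cofibrant_iff Y).2 hY)
        exact ⟨Z.unop, p.unop, i.unop, Quiver.Hom.op_inj (by simpa using fac), hp, hi, hW⟩
      fact_trivCof_fib := fun X Y f hY => by
        obtain ⟨Z, i, p, fac, hi, hp, hW⟩ :=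
          h.fact_cof_trivFib f.op ((P.op_cofibrant_iff Y).2 hY)
        exact ⟨Z.unop, p.unop, i.unop, Quiver.Hom.op_inj (by simpa using fac), hp, hW, hi⟩
      lift := fun A B X Y i p hY hi hp hW => HasLiftingProperty.iff_op.2
        (h.lift p.op i.op ((P.op_cofibrant_iff Y).2 hY) hp hi hW.symm)
      pushout_cof := inferInstance
      fibrant_terminal :=
        (fibrant_iff_of_isTerminal terminalIsTerminal (𝟙 _)).2 (P.fib.id_mem _) }
  · intro h
    have := h.two_out_of_three
    have := h.retract_W
    exact
    { two_out_of_three := inferInstance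
      retract_W := inferInstance
      retract_cof := inferInstance
      retract_fib := inferInstance
      fact_cof_trivFib := fun X Y f hX => by
        obtain ⟨Z, i, p, fac, hi, hW, hp⟩ :=
          h.fact_trivCof_fib f.unop ((P.op_cofibrant_iff _).1 hX)
        exact ⟨.op Z, p.op, i.op, Quiver.Hom.unop_inj (by simpa using fac), hp, hi, hW⟩
      fact_trivCof_fib := fun X Y f hX => by
        obtain ⟨Z, i, p, fac, hi, hp, hW⟩ :=
          h.fact_cof_trivFib f.unop ((P.op_cofibrant_iff _).1 hX)
        exact ⟨.op Z, p.op, i.op, Quiver.Hom.unop_inj (by simpa using fac), hp, hW, hi⟩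
      lift := fun A B X Y i p hA hi hp hW => (HasLiftingProperty.iff_unop _ _).2
        (h.lift p.unop i.unop ((P.op_cofibrant_iff _).1 hA) hp hi hW.symm)
      pullback_fib := inferInstance
      cofibrant_initial := P.op.cofibrant_initial }

lemma op_isSpitzweckLeftSemiModel_iff (W : MorphismProperty C) :
    IsSpitzweckLeftSemiModel W.op P.op.cof P.op.fib ↔
      IsSpitzweckRightSemiModel W P.cof P.fib :=
  ⟨fun h => { (P.op_isFresseLeftSemiModel_iff W).1 h.toIsFresseLeftSemiModel with
      wfs := isWeakFactorizationSystem_unop h.wfs },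
    fun h => { (P.op_isFresseLeftSemiModel_iff W).2 h.toIsFresseRightSemiModel with
      wfs := isWeakFactorizationSystem_op h.wfs }⟩

/-- Classes of maps of `C` and of its opposite correspond to each other. -/
lemma exists_op_iff {p : MorphismProperty Cᵒᵖ → Prop} :
    (∃ W, p W) ↔ ∃ W : MorphismProperty C, p W.op :=
  ⟨fun ⟨W, h⟩ => ⟨W.unop, h⟩, fun ⟨W, h⟩ => ⟨W.op, h⟩⟩

theorem right_semiModel :
    ((∃ W : MorphismProperty C, IsFresseRightSemiModel W P.cof P.fib) ↔ P.IsRightSemi) ∧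
    (P.IsRightSemi → ∃! W : MorphismProperty C, IsFresseRightSemiModel W P.cof P.fib) ∧
    ((∃ W : MorphismProperty C, IsSpitzweckRightSemiModel W P.cof P.fib) ↔
      (P.IsRightSemi ∧ P.LeftSaturated)) ∧
    (∀ W : MorphismProperty C, IsFresseRightSemiModel W P.cof P.fib →
      (IsSpitzweckRightSemiModel W P.cof P.fib ↔ P.LeftSaturated)) := by
  have h := P.op.left_semiModel
  simp only [exists_op_iff, op_isFresseLeftSemiModel_iff, op_isSpitzweckLeftSemiModel_iff,
    op_isLeftSemi_iff, op_rightSaturated_iff] at h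
  obtain ⟨h₁, h₂, h₃, h₄⟩ := h
  refine ⟨h₁, fun hP => ?_, h₃, fun W hW => ?_⟩
  · obtain ⟨W, hW⟩ := h₁.2 hP
    refine ⟨W, hW, fun W' hW' => ?_⟩
    exact congrArg MorphismProperty.unop ((h₂ hP).unique
      ((P.op_isFresseLeftSemiModel_iff W').2 hW') ((P.op_isFresseLeftSemiModel_iff W).2 hW))
  · rw [← op_isSpitzweckLeftSemiModel_iff]
    exact h₄ W.op ((P.op_isFresseLeftSemiModel_iff W).2 hW)

end PremodelStructure

theorem mainTheorem1 {C : Type u} [Category.{v} C] [HasLimits C] [HasColimits C]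
    (P : PremodelStructure C) :
    -- left semi-model categories
    (((∃ W : MorphismProperty C, IsFresseLeftSemiModel W P.cof P.fib) ↔
        (P.IsWeakModel ∧ (∀ X : C, P.Cofibrant X → P.HasStrongCylinder X) ∧
          P.CoreLeftSaturated)) ∧
      ((P.IsWeakModel ∧ (∀ X : C, P.Cofibrant X → P.HasStrongCylinder X) ∧
          P.CoreLeftSaturated) →
        ∃! W : MorphismProperty C, IsFresseLeftSemiModel W P.cof P.fib) ∧
      ((∃ W : MorphismProperty C, IsSpitzweckLeftSemiModel W P.cof P.fib) ↔
        ((P.IsWeakModel ∧ (∀ X : C, P.Cofibrant X → P.HasStrongCylinder X) ∧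
          P.CoreLeftSaturated) ∧ P.RightSaturated)) ∧
      (∀ W : MorphismProperty C, IsFresseLeftSemiModel W P.cof P.fib →
        (IsSpitzweckLeftSemiModel W P.cof P.fib ↔ P.RightSaturated))) ∧
    -- right semi-model categories
    (((∃ W : MorphismProperty C, IsFresseRightSemiModel W P.cof P.fib) ↔
        (P.IsWeakModel ∧ (∀ X : C, P.Fibrant X → P.HasStrongPath X) ∧
          P.CoreRightSaturated)) ∧
      ((P.IsWeakModel ∧ (∀ X : C, P.Fibrant X → P.HasStrongPath X) ∧
          P.CoreRightSaturated) →
        ∃! W : MorphismProperty C, IsFresseRightSemiModel W P.cof P.fib) ∧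
      ((∃ W : MorphismProperty C, IsSpitzweckRightSemiModel W P.cof P.fib) ↔
        ((P.IsWeakModel ∧ (∀ X : C, P.Fibrant X → P.HasStrongPath X) ∧
          P.CoreRightSaturated) ∧ P.LeftSaturated)) ∧
      (∀ W : MorphismProperty C, IsFresseRightSemiModel W P.cof P.fib →
        (IsSpitzweckRightSemiModel W P.cof P.fib ↔ P.LeftSaturated))) :=
  ⟨P.left_semiModel, P.right_semiModel⟩
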